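/- Let $\mathcal L$ be a finite modular semilattice, i.e. a finite meet-semilattice such that for every $p\in\mathcal L$ the principal ideal $\{x\in\mathcal L : x\preceq p\}$ is a modular lattice, and such that $x\vee y\vee z$ exists whenever $x\vee y$, $y\vee z$ and $z\vee x$ exist. Let $v:\mathcal L\to\mathbb R$ be a valuation: $v(q)-v(p)>0$ whenever $p\prec q$, and $v(p)+v(q)=v(p\wedge q)+v(p\vee q)$ whenever $p\vee q$ exists. Let $\mu$ be the path metric of the covering graph of $\mathcal L$, where the edge between $a$ and $b$, with $b$ covering $a$, has length $v(b)-v(a)$, and let $I(p,q)=\{u\in\mathcal L : \mu(p,u)+\mu(u,q)=\mu(p,q)\}$. For $u\in I(p,q)$ put $$v_{pq}(u)=\bigl(v(u\wedge p)-v(p\wedge q),\; v(u\wedge q)-v(p\wedge q)\bigr)\in\mathbb R^2,$$ and let $\operatorname{Conv} I(p,q)$ be the convex hull of $\{v_{pq}(u) : u\in I(p,q)\}$. The $(p,q)$-envelope $\mathcal E(p,q)$ is the set of all $u\in I(p,q)$ such that $v_{pq}(u)$ is a maximal extreme point of $\operatorname{Conv} I(p,q)$, where maximal means that no point of $\operatorname{Conv}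 I(p,q)$ is strictly larger in both coordinates (so $p,q\in\mathcal E(p,q)$ always). For $u,u'\in\mathcal L$ write $(p,q)\lhd(u,u')$ if $u,u'\in I(p,q)\setminus\{p,q\}$ and the point $\frac12\bigl(v_{pq}(u)+v_{pq}(u')\bigr)$ lies strictly above the segment $[v_{pq}(p),v_{pq}(q)]$ in $\mathbb R^2$. Let $f:\mathcal L\to\mathbb R\cup\{\infty\}$ and $\operatorname{dom} f=\{x\in\mathcal L : f(x)<\infty\}$. Then the following two conditions are equivalent: (1) $\mathcal E(p,q)\subseteq\operatorname{dom} f$ for all $p,q\in\operatorname{dom} f$. (1$'$) Suppose that $p,q\in\operatorname{dom} f$ and $\mathcal E(p,q)\neq\{p,q\}$. Let $u^-$ and $u^+$ be the elements of $\mathcal E(p,q)\setminus\{p,q\}$ that are closest (with respect to $\mu$) to $p$ and to $q$, respectively. Then there exists $t\in\operatorname{dom} f$ such that $(p,q)\lhd(u^-,t)$ or $(p,q)\lhd(u^+,t)$. -/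

import Mathlib

/-- A modular semilattice: a meet-semilattice in which every principal ideal `{x | x ≤ p}` is a
modular lattice, and in which `x ∨ y ∨ z` exists as soon as `x ∨ y`, `y ∨ z` and `z ∨ x` exist.
Joins are only partially defined, so they are expressed through `IsLUB`. -/
structure IsModularSemilattice (L : Type*) [SemilatticeInf L] : Prop where
  /-- Every principal ideal is a lattice. -/
  exists_join : ∀ (p : L) (x y : Set.Iic p), ∃ j : Set.Iic p, IsLUB {x, y} j
  /-- Every principal ideal satisfies the modular law `x ∨ (y ∧ z) = (x ∨ y) ∧ z` for `x ≤ z`. -/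
  modular_law : ∀ (p : L) (x y z : Set.Iic p), x ≤ z →
    ∀ j k : Set.Iic p, IsLUB {x, y ⊓ z} j → IsLUB {x, y} k → j = k ⊓ z
  /-- Three elements have a join if they have pairwise joins. -/
  exists_triple_join : ∀ x y z : L,
    (∃ j, IsLUB {x, y} j) → (∃ j, IsLUB {y, z} j) → (∃ j, IsLUB {z, x} j) →
      ∃ j, IsLUB {x, y, z} j

/-- A (positive) valuation of a meet-semilattice. -/
structure IsValuation {L : Type*} [SemilatticeInf L] (v : L → ℝ) : Prop where
  /-- `v` is strictly increasing. -/
  pos : ∀ p q : L, p < q → 0 < v q - v p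
  /-- `v` is modular on pairs that have a join. -/
  modular : ∀ p q j : L, IsLUB {p, q} j → v p + v q = v (p ⊓ q) + v j

section Envelope

variable {L : Type*} [SemilatticeInf L] (v : L → ℝ)

/-- The length of a walk in the covering graph, where the edge between `a` and `b`, with `b`
covering `a`, has length `v b - v a`. -/
def walkLength {p q : L} (W : (SimpleGraph.hasse L).Walk p q) : ℝ :=
  (W.darts.map fun e => |v e.snd - v e.fst|).sum

/-- The path metric `μ` of the weighted covering graph. -/
noncomputable def pathMetric (p q : L) : ℝ :=
  sInf (Set.range fun W : (SimpleGraph.hasse L).Walk p q => walkLength v W)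

/-- The metric interval `I(p,q)`. -/
def metricInterval (p q : L) : Set L :=
  {u | pathMetric v p u + pathMetric v u q = pathMetric v p q}

/-- The vector `v_{pq}(u) = (v[s, u ∧ p], v[s, u ∧ q])` with `s = p ∧ q`. -/
def coordVec (p q u : L) : ℝ × ℝ :=
  (v (u ⊓ p) - v (p ⊓ q), v (u ⊓ q) - v (p ⊓ q))

/-- `Conv I(p,q)`, the convex hull of the vectors `v_{pq}(u)` for `u ∈ I(p,q)`. -/
def convInterval (p q : L) : Set (ℝ × ℝ) :=
  convexHull ℝ (coordVec v p q '' metricInterval v p q)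

/-- The `(p,q)`-envelope `ℰ(p,q)`: the elements `u` of `I(p,q)` for which `v_{pq}(u)` is a maximal
extreme point of `Conv I(p,q)`. Maximal means that no point of `Conv I(p,q)` is larger in both
coordinates, equivalently that some `⟨(1 - θ, θ), ·⟩` with `θ ∈ [0,1]` is maximized there; so `p`
and `q` always belong to `ℰ(p,q)`, even when they have a join. -/
def envelope (p q : L) : Set L :=
  {u | u ∈ metricInterval v p q ∧
    coordVec v p q u ∈ Set.extremePoints ℝ (convInterval v p q) ∧
    ¬ ∃ y ∈ convInterval v p q, (coordVec v p q u).1 < y.1 ∧ (coordVec v p q u).2 < y.2}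

/-- The point `m` of the plane lies strictly above the segment `[a,b]`. -/
def StrictlyAboveSegment (a b m : ℝ × ℝ) : Prop :=
  (∃ z ∈ segment ℝ a b, z.1 = m.1) ∧ ∀ z ∈ segment ℝ a b, z.1 = m.1 → z.2 < m.2

/-- The relation `(p,q) ⊲ (u,u')`: both `u` and `u'` lie in `I(p,q) - {p,q}`, and the midpoint of
`v_{pq}(u)` and `v_{pq}(u')` lies strictly above the segment `[v_{pq}(p), v_{pq}(q)]`. -/
def MidpointAbove (p q u u' : L) : Prop :=
  u ∈ metricInterval v p q \ {p, q} ∧ u' ∈ metricInterval v p q \ {p, q} ∧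
    StrictlyAboveSegment (coordVec v p q p) (coordVec v p q q)
      ((1 / 2 : ℝ) • (coordVec v p q u + coordVec v p q u'))

/-- `u` is an element of `ℰ(p,q) - {p,q}` that is closest to `r`. -/
def IsClosestInEnvelope (p q r u : L) : Prop :=
  u ∈ envelope v p q \ {p, q} ∧
    ∀ w ∈ envelope v p q \ {p, q}, pathMetric v r u ≤ pathMetric v r w

end Envelope

/-- The effective domain of a function with values in `ℝ ∪ {∞}`. -/
def effDomain {L : Type*} (f : L → WithTop ℝ) : Set L := {x | f x < ⊤}

/-! ### Valuations and the path metric -/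

section Semilattice

variable {L : Type*} [SemilatticeInf L] {v : L → ℝ}

/-! The path metric is `v p + v q - 2 * v (p ⊓ q)`, so `u` lies in `I(p,q)` exactly when `u` is
above `p ∧ q` and is the join of `u ∧ p` and `u ∧ q`. An element of the interval is thus a pair `(u
∧ p, u ∧ q)`. The triple-join axiom closes the set of these pairs under the twisted operation that
joins one component and meets the other. Hence `t`, `u` in `I(p,q)` yield `x` in `I(p,t)` and `y` in
`I(t,q)` whose vectors satisfy `x + y = t + u` (`exists_parallelogram`).

(1) ⇒ (1'): take `t = u⁻`. The midpoint is then the vector of `u⁻` itself, and envelope points other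
than `p`, `q` lie strictly above the segment.

(1') ⇒ (1): induct on the size of `I(p,q)`, with `D = dom f` and `w` a positive functional constant
on the segment. By induction, for `t` in `D` other than `p`, `q`, every point of `I(p,t)` or
`I(t,q)` is dominated under `w` by a point of `D`. Choose `t` maximizing `w` on `I(p,q) ∩ D`. The
parallelogram on the pair supplied by (1') shows that `w` at `t` exceeds its value on the segment,
so `t` is neither `p` nor `q`. For `e` in the envelope, the parallelogram on `t` and `e` has its
neighbours of `t` no higher than `t`. Planar convexity (`eq_of_parallelogram`) then makes it
degenerate, so `e` lies in `I(p,t)` or `I(t,q)`, belongs to the smaller envelope, and is in `D` by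
induction. -/

theorem IsValuation.strictMono (hv : IsValuation v) : StrictMono v :=
  fun p q h => sub_pos.1 (hv.pos p q h)

theorem IsValuation.eq_of_le (hv : IsValuation v) {x y : L} (h : x ≤ y) (he : v y ≤ v x) :
    x = y :=
  h.eq_of_not_lt fun hlt => (hv.strictMono hlt).not_ge he

theorem IsModularSemilattice.exists_isLUB (hL : IsModularSemilattice L) {x y z : L}
    (hx : x ≤ z) (hy : y ≤ z) : ∃ j, IsLUB {x, y} j ∧ j ≤ z := by
  obtain ⟨j, hj⟩ := hL.exists_join z ⟨x, hx⟩ ⟨y, hy⟩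
  refine ⟨j, ⟨?_, fun b hb => ?_⟩, j.2⟩
  · rintro _ (rfl | rfl)
    · exact hj.1 (Set.mem_insert _ _)
    · exact hj.1 (Set.mem_insert_of_mem _ rfl)
  -- Meeting an arbitrary upper bound with `z` brings it into the ideal, so a join in the ideal is a
  -- join in the whole semilattice.
  · have h : j ≤ (⟨b ⊓ z, inf_le_right⟩ : Set.Iic z) := by
      apply hj.2
      rintro _ (rfl | rfl)
      · exact le_inf (hb (Set.mem_insert _ _)) hx
      · exact le_inf (hb (Set.mem_insert_of_mem _ rfl)) hy
    exact le_trans (show (j : L) ≤ b ⊓ z from h) inf_le_left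

theorem isLUB_pair_iff {x y j : L} :
    IsLUB {x, y} j ↔ x ≤ j ∧ y ≤ j ∧ ∀ b, x ≤ b → y ≤ b → j ≤ b := by
  constructor
  · intro h
    refine ⟨h.1 (by simp), h.1 (by simp), fun b hx hy => h.2 ?_⟩
    rintro _ (rfl | rfl) <;> assumption
  · rintro ⟨hx, hy, h⟩
    refine ⟨?_, fun b hb => h b (hb (by simp)) (hb (by simp))⟩
    rintro _ (rfl | rfl) <;> assumption

/-- The pairs `(x, y)` and `(j ⊓ p, y)` have the same join `j` and the same meet `p ⊓ q`, so `v`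
agrees on the comparable elements `x` and `j ⊓ p`. -/
theorem inf_eq_of_isLUB (hv : IsValuation v) {p q x y j : L} (hx : p ⊓ q ≤ x) (hxp : x ≤ p)
    (hy : p ⊓ q ≤ y) (hyq : y ≤ q) (hj : IsLUB {x, y} j) : j ⊓ p = x := by
  obtain ⟨hxj, hyj, hlub⟩ := isLUB_pair_iff.1 hj
  have h1 := hv.modular _ _ _ hj
  have h2 := hv.modular (j ⊓ p) y j (isLUB_pair_iff.2
    ⟨inf_le_left, hyj, fun b hb => hlub b ((le_inf hxj hxp).trans hb)⟩)
  rw [show x ⊓ y = p ⊓ q from (inf_le_inf hxp hyq).antisymm (le_inf hx hy)] at h1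
  rw [show j ⊓ p ⊓ y = p ⊓ q from (inf_le_inf inf_le_right hyq).antisymm
    (le_inf (le_inf (hx.trans hxj) inf_le_left) hy)] at h2
  exact (hv.eq_of_le (le_inf hxj hxp) (by linarith)).symm

/-- The triangle inequality for the explicit distance, in disguise: the join of `u ⊓ p` and `u ⊓ q`
exists below `u`. -/
theorem IsModularSemilattice.valuation_inf_le (hL : IsModularSemilattice L)
    (hv : IsValuation v) (p q u : L) :
    v (u ⊓ p) + v (u ⊓ q) ≤ v u + v (p ⊓ q) := by
  obtain ⟨j, hj, hju⟩ := hL.exists_isLUB (inf_le_left : u ⊓ p ≤ u) (inf_le_left : u ⊓ q ≤ u)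
  have h1 := hv.modular _ _ _ hj
  have h2 := hv.strictMono.monotone hju
  have h3 : v (u ⊓ p ⊓ (u ⊓ q)) ≤ v (p ⊓ q) :=
    hv.strictMono.monotone (inf_le_inf inf_le_right inf_le_right)
  linarith

theorem le_walkLength (hL : IsModularSemilattice L) (hv : IsValuation v) {p q : L}
    (W : (SimpleGraph.hasse L).Walk p q) : v p + v q - 2 * v (p ⊓ q) ≤ walkLength v W := by
  induction W with
  | nil => simp [walkLength]; linarith
  | @cons p r q h W ih =>
    have h1 := hL.valuation_inf_le hv p q r
    have h2 : walkLength v (SimpleGraph.Walk.cons h W) = |v r - v p| + walkLength v W := by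
      simp [walkLength]
    have h3 : v p + v r - 2 * v (r ⊓ p) ≤ |v r - v p| := by
      rcases h with h | h
      · rw [inf_eq_right.2 h.le]
        exact le_trans (by linarith) (le_abs_self _)
      · rw [inf_eq_left.2 h.le]
        exact le_trans (by linarith) (neg_le_abs _)
    rw [h2]
    linarith

theorem exists_walk_of_le [Finite L] (hv : IsValuation v) {a b : L} (h : a ≤ b) :
    (∃ W : (SimpleGraph.hasse L).Walk a b, walkLength v W = v b - v a) ∧
      ∃ W : (SimpleGraph.hasse L).Walk b a, walkLength v W = v b - v a := by
  induction a using WellFoundedGT.induction with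
  | _ a ih =>
    rcases h.eq_or_lt with rfl | hlt
    · exact ⟨⟨.nil, by simp [walkLength]⟩, ⟨.nil, by simp [walkLength]⟩⟩
    · obtain ⟨c, hac, hcb⟩ := exists_covBy_le_of_lt hlt
      obtain ⟨⟨W, hW⟩, ⟨W', hW'⟩⟩ := ih c hac.lt hcb
      have hpos := hv.strictMono hac.lt
      have hadj : (SimpleGraph.hasse L).Adj a c := Or.inl hac
      refine ⟨⟨.cons hadj W, ?_⟩, ⟨W'.concat hadj.symm, ?_⟩⟩
      · have : walkLength v (SimpleGraph.Walk.cons hadj W) = |v c - v a| + walkLength v W := by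
          simp [walkLength]
        rw [this, hW, abs_of_pos (sub_pos.2 hpos)]
        ring
      · have : walkLength v (W'.concat hadj.symm) = walkLength v W' + |v a - v c| := by
          simp [walkLength, SimpleGraph.Walk.darts_concat]
        rw [this, hW', abs_of_neg (sub_neg.2 hpos)]
        ring

theorem walkLength_append {p q r : L} (W : (SimpleGraph.hasse L).Walk p q)
    (W' : (SimpleGraph.hasse L).Walk q r) :
    walkLength v (W.append W') = walkLength v W + walkLength v W' := by
  simp [walkLength, SimpleGraph.Walk.darts_append]

/-- The lower bound is attained by descending from `p` to `p ⊓ q` and climbing to `q`. -/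
theorem pathMetric_eq [Finite L] (hL : IsModularSemilattice L) (hv : IsValuation v) (p q : L) :
    pathMetric v p q = v p + v q - 2 * v (p ⊓ q) := by
  obtain ⟨W, hW⟩ := (exists_walk_of_le hv (inf_le_left : p ⊓ q ≤ p)).2
  obtain ⟨W', hW'⟩ := (exists_walk_of_le hv (inf_le_right : p ⊓ q ≤ q)).1
  have hmem : v p + v q - 2 * v (p ⊓ q) ∈
      Set.range fun W : (SimpleGraph.hasse L).Walk p q => walkLength v W :=
    ⟨W.append W', by simp only [walkLength_append, hW, hW']; ring⟩
  have hlb : v p + v q - 2 * v (p ⊓ q) ∈ lowerBounds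
      (Set.range fun W : (SimpleGraph.hasse L).Walk p q => walkLength v W) := by
    rintro _ ⟨W, rfl⟩
    exact le_walkLength hL hv W
  exact (IsLeast.csInf_eq ⟨hmem, hlb⟩)

variable [Finite L]

theorem pathMetric_comm (hL : IsModularSemilattice L) (hv : IsValuation v) (p q : L) :
    pathMetric v p q = pathMetric v q p := by
  rw [pathMetric_eq hL hv, pathMetric_eq hL hv, inf_comm]
  ring

theorem pathMetric_triangle (hL : IsModularSemilattice L) (hv : IsValuation v) (p q r : L) :
    pathMetric v p r ≤ pathMetric v p q + pathMetric v q r := by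
  simp only [pathMetric_eq hL hv]
  have := hL.valuation_inf_le hv p r q
  rw [inf_comm p q]
  linarith

theorem pathMetric_self (hL : IsModularSemilattice L) (hv : IsValuation v) (p : L) :
    pathMetric v p p = 0 := by
  rw [pathMetric_eq hL hv, inf_idem]
  ring

theorem eq_of_pathMetric_le_zero (hL : IsModularSemilattice L) (hv : IsValuation v) {p q : L}
    (h : pathMetric v p q ≤ 0) : p = q := by
  rw [pathMetric_eq hL hv] at h
  have h1 := hv.strictMono.monotone (inf_le_left : p ⊓ q ≤ p)
  have h2 := hv.strictMono.monotone (inf_le_right : p ⊓ q ≤ q)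
  rw [← hv.eq_of_le (inf_le_left : p ⊓ q ≤ p) (by linarith)]
  exact hv.eq_of_le inf_le_right (by linarith)

/-! ### Metric intervals -/

theorem mem_metricInterval_iff_valuation (hL : IsModularSemilattice L) (hv : IsValuation v)
    {p q u : L} : u ∈ metricInterval v p q ↔ v (u ⊓ p) + v (u ⊓ q) = v u + v (p ⊓ q) := by
  simp only [metricInterval, Set.mem_ofPred_eq, pathMetric_eq hL hv, inf_comm p u]
  constructor <;> intro h <;> linarith

/-- This is the equality case of `valuation_inf_le`: both estimates in its proof must be tight, and
strict monotonicity turns equal values into equal elements. -/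
theorem mem_metricInterval_iff (hL : IsModularSemilattice L) (hv : IsValuation v) {p q u : L} :
    u ∈ metricInterval v p q ↔ p ⊓ q ≤ u ∧ IsLUB {u ⊓ p, u ⊓ q} u := by
  rw [mem_metricInterval_iff_valuation hL hv]
  have hle : u ⊓ p ⊓ (u ⊓ q) ≤ p ⊓ q := inf_le_inf inf_le_right inf_le_right
  constructor
  · intro h
    obtain ⟨j, hj, hju⟩ := hL.exists_isLUB (inf_le_left : u ⊓ p ≤ u) (inf_le_left : u ⊓ q ≤ u)
    have h1 := hv.modular _ _ _ hj
    have h2 := hv.strictMono.monotone hju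
    have h3 := hv.strictMono.monotone hle
    refine ⟨?_, ?_⟩
    · rw [← hv.eq_of_le hle (by linarith)]
      exact inf_le_left.trans inf_le_left
    · rwa [hv.eq_of_le hju (by linarith)] at hj
  · rintro ⟨h1, h2⟩
    rw [hv.modular _ _ _ h2, hle.antisymm
      (le_inf (le_inf h1 inf_le_left) (le_inf h1 inf_le_right)), add_comm]

theorem left_mem_metricInterval (hL : IsModularSemilattice L) (hv : IsValuation v) (p q : L) :
    p ∈ metricInterval v p q := by
  simp [metricInterval, pathMetric_self hL hv]

theorem right_mem_metricInterval (hL : IsModularSemilattice L) (hv : IsValuation v) (p q : L) :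
    q ∈ metricInterval v p q := by
  simp [metricInterval, pathMetric_self hL hv]

theorem metricInterval_comm (hL : IsModularSemilattice L) (hv : IsValuation v) (p q : L) :
    metricInterval v p q = metricInterval v q p := by
  ext u
  simp only [metricInterval, Set.mem_ofPred_eq, pathMetric_comm hL hv p, pathMetric_comm hL hv u q]
  rw [add_comm]

theorem metricInterval_ssubset (hL : IsModularSemilattice L) (hv : IsValuation v) {p q t : L}
    (ht : t ∈ metricInterval v p q) (htq : t ≠ q) :
    metricInterval v p t ⊂ metricInterval v p q := by
  simp only [metricInterval, Set.mem_ofPred_eq] at ht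
  refine (Set.ssubset_iff_of_subset fun u hu => ?_).2
    ⟨q, right_mem_metricInterval hL hv p q, fun hq => htq ?_⟩
  · simp only [metricInterval, Set.mem_ofPred_eq] at hu ⊢
    have h1 := pathMetric_triangle hL hv u t q
    have h2 := pathMetric_triangle hL hv p u q
    linarith
  -- If `q` were in `I(p,t)`, then `q` and `t` would each lie between `p` and the other, forcing
  -- distance zero.
  · simp only [metricInterval, Set.mem_ofPred_eq, pathMetric_comm hL hv q] at hq
    exact eq_of_pathMetric_le_zero hL hv (by linarith)

theorem metricInterval_ssubset' (hL : IsModularSemilattice L) (hv : IsValuation v) {p q t : L}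
    (ht : t ∈ metricInterval v p q) (htp : t ≠ p) :
    metricInterval v t q ⊂ metricInterval v p q := by
  rw [metricInterval_comm hL hv t q, metricInterval_comm hL hv p q] at *
  exact metricInterval_ssubset hL hv ht htp

theorem mem_metricInterval_left (hL : IsModularSemilattice L) (hv : IsValuation v) {p q t u : L}
    (hu : u ∈ metricInterval v p q) (h1 : t ⊓ p ≤ u ⊓ p) (h2 : u ⊓ q ≤ t ⊓ q) :
    u ∈ metricInterval v p t := by
  rw [mem_metricInterval_iff hL hv] at hu ⊢
  refine ⟨by rw [inf_comm]; exact h1.trans inf_le_left, isLUB_pair_iff.2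
    ⟨inf_le_left, inf_le_left, fun b hb hb' => (isLUB_pair_iff.1 hu.2).2.2 b hb ?_⟩⟩
  exact (le_inf inf_le_left (h2.trans inf_le_left)).trans hb'

/-- A metric interval is closed under `(a, b), (c, d) ↦ (a ∨ c, b ∧ d)`, where an element `u` is
identified with the pair `(u ∧ p, u ∧ q)`. -/
theorem exists_twisted_sup (hL : IsModularSemilattice L) (hv : IsValuation v) {p q t u : L}
    (ht : t ∈ metricInterval v p q) (hu : u ∈ metricInterval v p q) :
    ∃ x ∈ metricInterval v p q, x ∈ metricInterval v p t ∧
      IsLUB {t ⊓ p, u ⊓ p} (x ⊓ p) ∧ x ⊓ q = t ⊓ q ⊓ (u ⊓ q) := by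
  obtain ⟨ht0, ht1⟩ := (mem_metricInterval_iff hL hv).1 ht
  obtain ⟨hu0, hu1⟩ := (mem_metricInterval_iff hL hv).1 hu
  obtain ⟨a, ha, hap⟩ := hL.exists_isLUB (inf_le_right : t ⊓ p ≤ p) (inf_le_right : u ⊓ p ≤ p)
  -- The three pairs are bounded by `p`, `u` and `t` respectively.
  obtain ⟨j, hj⟩ := hL.exists_triple_join (t ⊓ p) (u ⊓ p) (t ⊓ q ⊓ (u ⊓ q)) ⟨a, ha⟩
    ((hL.exists_isLUB (z := u) inf_le_left (inf_le_right.trans inf_le_left)).imp fun _ h => h.1)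
    ((hL.exists_isLUB (z := t) (inf_le_left.trans inf_le_left) inf_le_left).imp fun _ h => h.1)
  obtain ⟨ha1, ha2, ha3⟩ := isLUB_pair_iff.1 ha
  have hlub : IsLUB {a, t ⊓ q ⊓ (u ⊓ q)} j := by
    refine isLUB_pair_iff.2 ⟨ha3 j (hj.1 (by simp)) (hj.1 (by simp)), hj.1 (by simp),
      fun b hb hb' => hj.2 ?_⟩
    rintro _ (rfl | rfl | rfl)
    exacts [ha1.trans hb, ha2.trans hb, hb']
  have hsa : p ⊓ q ≤ a := (le_inf ht0 inf_le_left).trans ha1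
  have hsb : p ⊓ q ≤ t ⊓ q ⊓ (u ⊓ q) :=
    le_inf (le_inf ht0 inf_le_right) (le_inf hu0 inf_le_right)
  have hbq : t ⊓ q ⊓ (u ⊓ q) ≤ q := inf_le_left.trans inf_le_right
  have hjp : j ⊓ p = a := inf_eq_of_isLUB hv hsa hap hsb hbq hlub
  have hjq : j ⊓ q = t ⊓ q ⊓ (u ⊓ q) := by
    rw [inf_comm] at hsa hsb
    rw [Set.pair_comm] at hlub
    exact inf_eq_of_isLUB hv hsb hbq hsa hap hlub
  have hmem : j ∈ metricInterval v p q := by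
    rw [mem_metricInterval_iff hL hv, hjp, hjq]
    exact ⟨hsa.trans (isLUB_pair_iff.1 hlub).1, hlub⟩
  refine ⟨j, hmem, mem_metricInterval_left hL hv hmem ?_ ?_, ?_, hjq⟩
  · rwa [hjp]
  · rw [hjq]
    exact inf_le_left
  · rwa [hjp]

/-- Two elements `t`, `u` of a metric interval give elements of `I(p,t)` and `I(t,q)` whose
coordinate vectors span a parallelogram with those of `t` and `u`. -/
theorem exists_parallelogram (hL : IsModularSemilattice L) (hv : IsValuation v) {p q t u : L}
    (ht : t ∈ metricInterval v p q) (hu : u ∈ metricInterval v p q) :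
    ∃ x ∈ metricInterval v p t, ∃ y ∈ metricInterval v t q,
      x ∈ metricInterval v p q ∧ y ∈ metricInterval v p q ∧
      coordVec v p q x + coordVec v p q y = coordVec v p q t + coordVec v p q u ∧
      (u ⊓ p ≤ x ⊓ p ∧ x ⊓ q ≤ u ⊓ q) ∧ (y ⊓ p ≤ u ⊓ p ∧ u ⊓ q ≤ y ⊓ q) ∧
      (t ⊓ p ≤ x ⊓ p ∧ x ⊓ q ≤ t ⊓ q) ∧ (y ⊓ p ≤ t ⊓ p ∧ t ⊓ q ≤ y ⊓ q) := by
  obtain ⟨x, hx, hxt, hxp, hxq⟩ := exists_twisted_sup hL hv ht hu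
  have hc := metricInterval_comm hL hv p q
  -- The same construction with `p` and `q` exchanged; modularity of `v` in each coordinate then
  -- gives the vector identity.
  obtain ⟨y, hy, hyt, hyq, hyp⟩ := exists_twisted_sup hL hv (hc ▸ ht) (hc ▸ hu)
  rw [metricInterval_comm hL hv] at hyt
  have h1 := hv.modular _ _ _ hxp
  have h2 := hv.modular _ _ _ hyq
  obtain ⟨h3, h4, -⟩ := isLUB_pair_iff.1 hxp
  obtain ⟨h5, h6, -⟩ := isLUB_pair_iff.1 hyq
  refine ⟨x, hxt, y, hyt, hx, hc ▸ hy, ?_, ⟨h4, hxq ▸ inf_le_right⟩,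
    ⟨hyp ▸ inf_le_right, h6⟩, ⟨h3, hxq ▸ inf_le_left⟩, ⟨hyp ▸ inf_le_left, h5⟩⟩
  ext <;> simp only [coordVec, Prod.fst_add, Prod.snd_add, hxq, hyp] <;> linarith

/-- The map `v_{pq}` need not be injective on `I(p,q)`; comparability of the components is what
allows strict monotonicity of `v` to separate elements. -/
theorem eq_of_coordVec_eq (hL : IsModularSemilattice L) (hv : IsValuation v) {p q u x : L}
    (hu : u ∈ metricInterval v p q) (hx : x ∈ metricInterval v p q) (h1 : u ⊓ p ≤ x ⊓ p)
    (h2 : x ⊓ q ≤ u ⊓ q) (h : coordVec v p q u = coordVec v p q x) : u = x := by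
  simp only [coordVec, Prod.mk.injEq, sub_left_inj] at h
  have hu' := ((mem_metricInterval_iff hL hv).1 hu).2
  rw [hv.eq_of_le h1 h.1.ge, ← hv.eq_of_le h2 h.2.le] at hu'
  exact hu'.unique ((mem_metricInterval_iff hL hv).1 hx).2

theorem eq_left_of_coordVec_eq (hL : IsModularSemilattice L) (hv : IsValuation v) {p q u : L}
    (hu : u ∈ metricInterval v p q) (h : coordVec v p q u = coordVec v p q p) : u = p :=
  eq_of_coordVec_eq hL hv hu (left_mem_metricInterval hL hv p q) (by simp)
    (le_inf ((mem_metricInterval_iff hL hv).1 hu).1 inf_le_right) h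

theorem eq_right_of_coordVec_eq (hL : IsModularSemilattice L) (hv : IsValuation v) {p q u : L}
    (hu : u ∈ metricInterval v p q) (h : coordVec v p q u = coordVec v p q q) : u = q := by
  refine (eq_of_coordVec_eq hL hv (right_mem_metricInterval hL hv p q) hu ?_ (by simp) h.symm).symm
  rw [inf_comm q p]
  exact le_inf ((mem_metricInterval_iff hL hv).1 hu).1 inf_le_left

/-- On either interval the second coordinate equals `v u - v (u ⊓ p)`, which does not involve the
other endpoint; the first changes only by its normalizing constant. -/
theorem coordVec_left_eq_add (hL : IsModularSemilattice L) (hv : IsValuation v) {p q t u : L}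
    (hu : u ∈ metricInterval v p q) (hut : u ∈ metricInterval v p t) :
    coordVec v p q u = coordVec v p t u + (v (p ⊓ t) - v (p ⊓ q), 0) := by
  rw [mem_metricInterval_iff_valuation hL hv] at hu hut
  ext <;> simp only [coordVec, Prod.fst_add, Prod.snd_add] <;> linarith

theorem coordVec_right_eq_add (hL : IsModularSemilattice L) (hv : IsValuation v) {p q t u : L}
    (hu : u ∈ metricInterval v p q) (hut : u ∈ metricInterval v t q) :
    coordVec v p q u = coordVec v t q u + (0, v (t ⊓ q) - v (p ⊓ q)) := by
  rw [mem_metricInterval_iff_valuation hL hv] at hu hut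
  ext <;> simp only [coordVec, Prod.fst_add, Prod.snd_add] <;> linarith

end Semilattice

/-! ### Planar convexity -/

/-- Points of the plane compared first by the value of a linear functional, then by the first
coordinate. -/
noncomputable def lexKey (w P : ℝ × ℝ) : ℝ ×ₗ ℝ := toLex (w.1 * P.1 + w.2 * P.2, P.1)

theorem lexKey_le_iff {w P Q : ℝ × ℝ} : lexKey w P ≤ lexKey w Q ↔
    w.1 * P.1 + w.2 * P.2 < w.1 * Q.1 + w.2 * Q.2 ∨
      w.1 * P.1 + w.2 * P.2 = w.1 * Q.1 + w.2 * Q.2 ∧ P.1 ≤ Q.1 := by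
  simp [lexKey, Prod.Lex.toLex_le_toLex]

theorem functional_le_of_lexKey_le {w P Q : ℝ × ℝ} (h : lexKey w P ≤ lexKey w Q) :
    w.1 * P.1 + w.2 * P.2 ≤ w.1 * Q.1 + w.2 * Q.2 :=
  (lexKey_le_iff.1 h).elim le_of_lt fun h => h.1.le

theorem lexKey_add_right {w P Q : ℝ × ℝ} (k : ℝ × ℝ) :
    lexKey w (P + k) ≤ lexKey w (Q + k) ↔ lexKey w P ≤ lexKey w Q := by
  simp only [lexKey_le_iff, Prod.fst_add, Prod.snd_add, mul_add]
  constructor <;> rintro (h | ⟨h, h'⟩) <;> first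
    | (left; linarith)
    | (right; constructor <;> linarith)

theorem convex_lexKey_le (w P : ℝ × ℝ) : Convex ℝ {Q | lexKey w Q ≤ lexKey w P} := by
  intro Q hQ R hR a b ha hb hab
  simp only [Set.mem_ofPred_eq, lexKey_le_iff, Prod.fst_add, Prod.snd_add, Prod.smul_fst,
    Prod.smul_snd, smul_eq_mul] at *
  set c := w.1 * P.1 + w.2 * P.2
  have key : w.1 * (a * Q.1 + b * R.1) + w.2 * (a * Q.2 + b * R.2) - c =
      a * (w.1 * Q.1 + w.2 * Q.2 - c) + b * (w.1 * R.1 + w.2 * R.2 - c) := by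
    linear_combination c * hab
  have key' : a * Q.1 + b * R.1 - P.1 = a * (Q.1 - P.1) + b * (R.1 - P.1) := by
    linear_combination P.1 * hab
  -- A strict inequality survives a convex combination only under a positive weight, so zero weights
  -- are treated apart.
  rcases ha.eq_or_lt with rfl | ha'
  · obtain rfl : b = 1 := by linarith
    simpa using hR
  rcases hb.eq_or_lt with rfl | hb'
  · obtain rfl : a = 1 := by linarith
    simpa using hQ
  rcases hQ with hQ | ⟨hQ, hQ'⟩
  · left
    have h1 := mul_neg_of_pos_of_neg ha' (sub_neg.2 hQ)
    have h2 : b * (w.1 * R.1 + w.2 * R.2 - c) ≤ 0 :=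
      mul_nonpos_of_nonneg_of_nonpos hb (by rcases hR with h | h <;> linarith)
    linarith
  · rcases hR with hR | ⟨hR, hR'⟩
    · left
      have h1 := mul_neg_of_pos_of_neg hb' (sub_neg.2 hR)
      rw [hQ, sub_self, mul_zero] at key
      linarith
    · right
      rw [hQ, hR, sub_self, mul_zero, mul_zero] at key
      have h1 := mul_nonpos_of_nonneg_of_nonpos ha (sub_nonpos.2 hQ')
      have h2 := mul_nonpos_of_nonneg_of_nonpos hb (sub_nonpos.2 hR')
      constructor <;> linarith

/-- A lexicographic maximizer of a positive functional is a maximal extreme point. -/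
theorem mem_extremePoints_of_lexKey {C : Set (ℝ × ℝ)} {w P : ℝ × ℝ} (h1 : 0 < w.1)
    (h2 : 0 < w.2) (hP : P ∈ C) (hmax : ∀ Q ∈ C, lexKey w Q ≤ lexKey w P) :
    P ∈ Set.extremePoints ℝ C ∧ ¬ ∃ y ∈ C, P.1 < y.1 ∧ P.2 < y.2 := by
  constructor
  · rw [mem_extremePoints_iff_left]
    refine ⟨hP, ?_⟩
    rintro Q hQ R hR ⟨a, b, ha, hb, hab, rfl⟩
    set P := a • Q + b • R
    have e1 : P.1 = a * Q.1 + b * R.1 := rfl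
    have e2 : P.2 = a * Q.2 + b * R.2 := rfl
    have key : a * (w.1 * Q.1 + w.2 * Q.2 - (w.1 * P.1 + w.2 * P.2)) +
        b * (w.1 * R.1 + w.2 * R.2 - (w.1 * P.1 + w.2 * P.2)) = 0 := by
      linear_combination (-w.1 * P.1 - w.2 * P.2) * hab - w.1 * e1 - w.2 * e2
    have key' : a * (Q.1 - P.1) + b * (R.1 - P.1) = 0 := by
      linear_combination (-P.1) * hab - e1
    have hQ' := lexKey_le_iff.1 (hmax Q hQ)
    have hR' := lexKey_le_iff.1 (hmax R hR)
    have f1 := functional_le_of_lexKey_le (hmax Q hQ)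
    have f2 := functional_le_of_lexKey_le (hmax R hR)
    -- Both ends of a segment through the maximizer attain the maximal functional value, then the
    -- maximal first coordinate; `w.2 ≠ 0` fixes the second.
    have g1 : w.1 * Q.1 + w.2 * Q.2 = w.1 * P.1 + w.2 * P.2 := by
      by_contra hne
      have := mul_neg_of_pos_of_neg ha (sub_neg.2 (lt_of_le_of_ne f1 hne))
      have := mul_nonpos_of_nonneg_of_nonpos hb.le (sub_nonpos.2 f2)
      linarith
    have g2 : w.1 * R.1 + w.2 * R.2 = w.1 * P.1 + w.2 * P.2 := by
      by_contra hne
      have := mul_neg_of_pos_of_neg hb (sub_neg.2 (lt_of_le_of_ne f2 hne))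
      have := mul_nonpos_of_nonneg_of_nonpos ha.le (sub_nonpos.2 f1)
      linarith
    have k1 : Q.1 ≤ P.1 := hQ'.elim (fun h => absurd h (by linarith)) fun h => h.2
    have k2 : R.1 ≤ P.1 := hR'.elim (fun h => absurd h (by linarith)) fun h => h.2
    have k : Q.1 = P.1 := by
      by_contra hne
      have := mul_neg_of_pos_of_neg ha (sub_neg.2 (lt_of_le_of_ne k1 hne))
      have := mul_nonpos_of_nonneg_of_nonpos hb.le (sub_nonpos.2 k2)
      linarith
    refine Prod.ext k ?_
    rw [k] at g1
    exact mul_left_cancel₀ h2.ne' (by linarith)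
  · rintro ⟨y, hy, hy1, hy2⟩
    have := functional_le_of_lexKey_le (hmax y hy)
    have := mul_lt_mul_of_pos_left hy1 h1
    have := mul_lt_mul_of_pos_left hy2 h2
    linarith

/-- If `T` maximizes a positive functional on a parallelogram whose sides at `T` point down-right
and up-left, then the vertex opposite to `T` can only be a maximal extreme point of a convex set
containing the parallelogram when the parallelogram is degenerate. -/
theorem eq_of_parallelogram {C : Set (ℝ × ℝ)} (hC : Convex ℝ C) {w T X Y U : ℝ × ℝ}
    (h1 : 0 < w.1) (h2 : 0 < w.2) (hT : T ∈ C) (hX : X ∈ C) (hY : Y ∈ C)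
    (hsum : X + Y = T + U) (hX1 : T.1 ≤ X.1) (hX2 : X.2 ≤ T.2) (hY1 : Y.1 ≤ T.1)
    (hY2 : T.2 ≤ Y.2) (hwX : w.1 * X.1 + w.2 * X.2 ≤ w.1 * T.1 + w.2 * T.2)
    (hwY : w.1 * Y.1 + w.2 * Y.2 ≤ w.1 * T.1 + w.2 * T.2) (hU : U ∈ Set.extremePoints ℝ C)
    (hmax : ¬ ∃ y ∈ C, U.1 < y.1 ∧ U.2 < y.2) : U = X ∨ U = Y := by
  by_contra! hne
  obtain ⟨hUX, hUY⟩ := hne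
  have hUT : U ≠ T := by
    rintro rfl
    refine hUX ((mem_extremePoints_iff_left.1 hU).2 X hX Y hY
      ⟨1 / 2, 1 / 2, by norm_num, by norm_num, by norm_num, ?_⟩).symm
    rw [← smul_add, hsum, ← two_smul ℝ U, smul_smul]
    norm_num
  have s1 : X.1 + Y.1 = T.1 + U.1 := congrArg Prod.fst hsum
  have s2 : X.2 + Y.2 = T.2 + U.2 := congrArg Prod.snd hsum
  obtain ⟨x, hx⟩ : ∃ x, x = X.1 - T.1 := ⟨_, rfl⟩
  obtain ⟨y, hy⟩ : ∃ y, y = T.2 - X.2 := ⟨_, rfl⟩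
  obtain ⟨x', hx'⟩ : ∃ x', x' = T.1 - Y.1 := ⟨_, rfl⟩
  obtain ⟨y', hy'⟩ : ∃ y', y' = Y.2 - T.2 := ⟨_, rfl⟩
  have hx0 : 0 ≤ x := by linarith
  have hy0 : 0 ≤ y := by linarith
  have hx'0 : 0 ≤ x' := by linarith
  have hy'0 : 0 ≤ y' := by linarith
  have hwx : w.1 * x ≤ w.2 * y := by rw [hx, hy]; linarith
  have hwy : w.2 * y' ≤ w.1 * x' := by rw [hx', hy']; linarith
  have hypos : 0 < y := by
    refine hy0.lt_of_ne' fun h0 => hUY ?_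
    have : x = 0 := by
      rw [h0, mul_zero] at hwx
      exact le_antisymm (nonpos_of_mul_nonpos_right hwx h1) hx0
    ext <;> linarith
  have hx'pos : 0 < x' := by
    refine hx'0.lt_of_ne' fun h0 => hUX ?_
    have : y' = 0 := by
      rw [h0, mul_zero] at hwy
      exact le_antisymm (nonpos_of_mul_nonpos_right hwy h2) hy'0
    ext <;> linarith
  -- Multiplying the two functional bounds eliminates `w`. The result says that `U` lies on or below
  -- the broken line `Y`, `T`, `X`.
  have hcross : x * y' ≤ y * x' := by
    have := mul_le_mul hwx hwy (by positivity) (by positivity)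
    have hw := mul_pos h1 h2
    refine le_of_mul_le_mul_left ?_ hw
    linarith
  -- the points of the two sides through `T`
  have notX : ∀ l : ℝ, 0 ≤ l → l ≤ 1 → U.1 < T.1 + l * x → T.2 - l * y ≤ U.2 := by
    intro l hl hl' hlt
    by_contra! hlt'
    refine hmax ⟨T + l • (X - T), hC.add_smul_sub_mem hT hX ⟨hl, hl'⟩, ?_, ?_⟩
    · simpa [hx] using hlt
    · simp only [Prod.snd_add, Prod.smul_snd, Prod.snd_sub, smul_eq_mul]
      rw [hy] at hlt'
      linarith
  have notY : ∀ l : ℝ, 0 ≤ l → l ≤ 1 → U.1 < T.1 - l * x' → T.2 + l * y' ≤ U.2 := by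
    intro l hl hl' hlt
    by_contra! hlt'
    refine hmax ⟨T + l • (Y - T), hC.add_smul_sub_mem hT hY ⟨hl, hl'⟩, ?_, ?_⟩
    · simp only [Prod.fst_add, Prod.smul_fst, Prod.fst_sub, smul_eq_mul]
      rw [hx'] at hlt
      linarith
    · simpa [hy'] using hlt'
  have openSeg : ∀ Z ∈ C, ∀ l : ℝ, 0 ≤ l → l < 1 → U ≠ T + l • (Z - T) := by
    intro Z hZ l hl hl' he
    rcases hl.eq_or_lt with rfl | hl
    · simp at he
      exact hUT he
    · refine hUT ((mem_extremePoints_iff_left.1 hU).2 T hT Z hZ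
        ⟨1 - l, l, by linarith, hl, by ring, ?_⟩).symm
      rw [he, smul_sub, sub_smul, one_smul]
      abel
  -- The parameter `l` picks the point of side `TY` or `TX` with the abscissa of `U`. If `U` is that
  -- point, extremality fails; if `U` is below it, a slight move to the right along the side
  -- strictly dominates `U`.
  rcases lt_or_ge x x' with hxx | hxx
  · obtain ⟨l, hl⟩ : ∃ l, l = 1 - x / x' := ⟨_, rfl⟩
    have hlx : l * x' = x' - x := by rw [hl]; field_simp
    have hlpos : 0 < l := by rw [hl, sub_pos, div_lt_one hx'pos]; exact hxx
    have hl1 : l ≤ 1 := by rw [hl]; linarith [div_nonneg hx0 hx'0]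
    have hg : y' - y ≤ l * y' := by
      refine le_of_mul_le_mul_right ?_ hx'pos
      calc (y' - y) * x' ≤ y' * (x' - x) := by linarith
        _ = l * y' * x' := by rw [← hlx]; ring
    rcases hg.eq_or_lt with hg | hg
    · rcases hl1.eq_or_lt with h | h
      · rw [h] at hg
        linarith
      · refine openSeg Y hY l hlpos.le h ?_
        ext
        · simp only [Prod.fst_add, Prod.smul_fst, Prod.fst_sub, smul_eq_mul]
          rw [hx'] at hlx
          linarith
        · simp only [Prod.snd_add, Prod.smul_snd, Prod.snd_sub, smul_eq_mul]
          rw [← hy']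
          linarith
    -- The shift keeps the parameter nonnegative and loses less height than the gap; the `+ 1` makes
    -- the loss strictly smaller and avoids division by zero.
    · obtain ⟨e, he⟩ : ∃ e, e = min l ((l * y' - (y' - y)) / (y' + 1)) := ⟨_, rfl⟩
      have hepos : 0 < e := by
        rw [he]
        exact lt_min hlpos (div_pos (by linarith) (by linarith))
      have hel : e ≤ l := he ▸ min_le_left _ _
      have hey : e * (y' + 1) ≤ l * y' - (y' - y) := by
        rw [← le_div_iff₀ (by linarith)]
        exact he ▸ min_le_right _ _
      have hex := mul_pos hepos hx'pos
      have := notY (l - e) (by linarith) (by linarith) (by linarith)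
      linarith
  · have hxpos : 0 < x := hx'pos.trans_le hxx
    obtain ⟨l, hl⟩ : ∃ l, l = 1 - x' / x := ⟨_, rfl⟩
    have hlx : l * x = x - x' := by rw [hl]; field_simp
    have hl0 : 0 ≤ l := by rw [hl, sub_nonneg, div_le_one hxpos]; exact hxx
    have hl1 : l < 1 := by rw [hl]; linarith [div_pos hx'pos hxpos]
    have hg : l * y ≤ y - y' := by
      refine le_of_mul_le_mul_right ?_ hxpos
      calc l * y * x = y * (x - x') := by rw [← hlx]; ring
        _ ≤ (y - y') * x := by linarith
    rcases hg.eq_or_lt with hg | hg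
    · refine openSeg X hX l hl0 hl1 ?_
      ext
      · simp only [Prod.fst_add, Prod.smul_fst, Prod.fst_sub, smul_eq_mul]
        rw [← hx]
        linarith
      · simp only [Prod.snd_add, Prod.smul_snd, Prod.snd_sub, smul_eq_mul]
        rw [hy] at hg
        linarith
    · obtain ⟨e, he⟩ : ∃ e, e = min (1 - l) ((y - y' - l * y) / (y + 1)) := ⟨_, rfl⟩
      have hepos : 0 < e := by
        rw [he]
        exact lt_min (by linarith) (div_pos (by linarith) (by linarith))
      have hel : e ≤ 1 - l := he ▸ min_le_left _ _
      have hey : e * (y + 1) ≤ y - y' - l * y := by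
        rw [← le_div_iff₀ (by linarith)]
        exact he ▸ min_le_right _ _
      have hex := mul_pos hepos hxpos
      have := notX (l + e) (by linarith) (by linarith) (by linarith)
      linarith

theorem StrictlyAboveSegment.pos_and_lt {a b : ℝ} {m : ℝ × ℝ} (ha : 0 ≤ a) (hb : 0 ≤ b)
    (hm : m.2 ≤ b) (h : StrictlyAboveSegment (a, 0) (0, b) m) :
    0 < a ∧ 0 < b ∧ a * b < b * m.1 + a * m.2 := by
  obtain ⟨⟨z, hz, hz1⟩, hall⟩ := h
  have hz2 := hall z hz hz1
  obtain ⟨s, r, hs, hr, hsr, rfl⟩ := hz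
  simp only [Prod.smul_mk, smul_eq_mul, mul_zero, Prod.mk_add_mk, add_zero, zero_add] at hz1 hz2
  -- For `a = 0` the segment is vertical with top `(0, b)`, which the bound `m.2 ≤ b` prevents `m`
  -- from exceeding.
  have ha' : 0 < a := by
    refine ha.lt_of_ne' fun h0 => ?_
    have := hall (0, b) (right_mem_segment _ _ _) (by rw [← hz1, h0, mul_zero])
    exact this.not_ge hm
  have hb' : 0 < b := by
    refine hb.lt_of_ne' fun h0 => ?_
    rw [h0] at hm hz2
    linarith
  refine ⟨ha', hb', ?_⟩
  have := mul_lt_mul_of_pos_left hz2 ha'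
  rw [← hz1]
  calc a * b = b * (s * a) + a * (r * b) := by linear_combination (-a * b) * hsr
    _ < _ := by linarith

/-- Maximal extreme points other than the two end points lie strictly above the segment. -/
theorem strictlyAboveSegment_of_extreme {C : Set (ℝ × ℝ)} (hC : Convex ℝ C) {a b : ℝ}
    {P : ℝ × ℝ} (ha : (a, 0) ∈ C) (hb : (0, b) ∈ C) (h1 : 0 ≤ P.1) (h1' : P.1 ≤ a)
    (h2 : 0 ≤ P.2) (hP : P ∈ Set.extremePoints ℝ C)
    (hmax : ¬ ∃ y ∈ C, P.1 < y.1 ∧ P.2 < y.2) (hPa : P ≠ (a, 0)) (hPb : P ≠ (0, b)) :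
    StrictlyAboveSegment (a, 0) (0, b) P := by
  have hseg : P ∉ segment ℝ ((a, 0) : ℝ × ℝ) (0, b) := fun h =>
    ((mem_extremePoints_iff_forall_segment.1 hP).2 _ ha _ hb h).elim
      (fun h => hPa h.symm) fun h => hPb h.symm
  constructor
  · rcases (h1.trans h1').eq_or_lt with h0 | h0
    · refine ⟨(a, 0), left_mem_segment _ _ _, ?_⟩
      simp only
      linarith
    · refine ⟨(P.1 / a) • (a, 0) + (1 - P.1 / a) • (0, b), ⟨P.1 / a, 1 - P.1 / a, by positivity,
        by rw [sub_nonneg, div_le_one h0]; exact h1', by ring, rfl⟩, ?_⟩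
      simp [div_mul_cancel₀ _ h0.ne']
  · rintro _ ⟨s, r, hs, hr, hsr, rfl⟩ hz
    simp only [Prod.smul_mk, smul_eq_mul, mul_zero, Prod.mk_add_mk, add_zero, zero_add] at hz ⊢
    by_contra! hle
    rcases hle.eq_or_lt with heq | hlt
    · exact hseg ⟨s, r, hs, hr, hsr, by ext <;> simp [hz, heq]⟩
    · have hrb : 0 < r * b := h2.trans_lt hlt
      have hr' : 0 < r := hr.lt_of_ne' fun h => by simp [h] at hrb
      have hb' : 0 < b := pos_of_mul_pos_right hrb hr
      rcases (h1.trans h1').eq_or_lt with h0 | h0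
      · have hlt1 : P.2 < b := hlt.trans_le (mul_le_of_le_one_left hb'.le (by linarith))
        refine hseg ⟨1 - P.2 / b, P.2 / b, ?_, by positivity, by ring, ?_⟩
        · rw [sub_nonneg, div_le_one hb']
          exact hlt1.le
        · ext
          · simp [← h0]
            linarith
          · simp [div_mul_cancel₀ _ hb'.ne']
      -- Sliding the point above `P` towards `(a, 0)` by less than the height gap makes it exceed
      -- `P` in both coordinates.
      · obtain ⟨e, he, he'⟩ : ∃ e, 0 < e ∧ e * b < r * b - P.2 := by
          refine ⟨(r * b - P.2) / (2 * b), div_pos (by linarith) (by linarith), ?_⟩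
          rw [div_mul_eq_mul_div, div_lt_iff₀ (by linarith)]
          nlinarith
        have her : e ≤ r := le_of_mul_le_mul_right (by linarith) hb'
        refine hmax ⟨(s + e) • (a, 0) + (r - e) • (0, b),
          hC ha hb (by linarith) (by linarith) (by linarith), ?_, ?_⟩
        · simp only [Prod.smul_mk, smul_eq_mul, mul_zero, Prod.mk_add_mk, add_zero]
          have := mul_pos he h0
          linarith
        · simp only [Prod.smul_mk, smul_eq_mul, mul_zero, Prod.mk_add_mk, zero_add]
          linarith

/-! ### Envelopes -/

section Envelopes

variable {L : Type*} [SemilatticeInf L] {v : L → ℝ}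

theorem coordVec_mem_convInterval {p q u : L} (hu : u ∈ metricInterval v p q) :
    coordVec v p q u ∈ convInterval v p q :=
  subset_convexHull ℝ _ ⟨u, hu, rfl⟩

theorem coordVec_left (p q : L) : coordVec v p q p = (v p - v (p ⊓ q), 0) := by
  simp [coordVec]

theorem coordVec_right (p q : L) : coordVec v p q q = (0, v q - v (p ⊓ q)) := by
  simp [coordVec, inf_comm q p]

theorem add_mem_convInterval {p q x y : L} {k : ℝ × ℝ}
    (hsub : metricInterval v x y ⊆ metricInterval v p q)
    (hk : ∀ u ∈ metricInterval v x y, coordVec v p q u = coordVec v x y u + k) {z : ℝ × ℝ}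
    (hz : z ∈ convInterval v x y) : z + k ∈ convInterval v p q := by
  have : convInterval v x y ⊆ (fun z => z + k) ⁻¹' convInterval v p q := by
    refine convexHull_min ?_ ((convex_convexHull ℝ _).translate_preimage_left k)
    rintro _ ⟨u, hu, rfl⟩
    rw [Set.mem_preimage, ← hk u hu]
    exact coordVec_mem_convInterval (hsub hu)
  exact this hz

/-- Passing to a smaller metric interval preserves membership in the envelope. -/
theorem mem_envelope_of_subset {p q x y u : L} {k : ℝ × ℝ}
    (hsub : metricInterval v x y ⊆ metricInterval v p q)
    (hk : ∀ u ∈ metricInterval v x y, coordVec v p q u = coordVec v x y u + k)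
    (hu : u ∈ metricInterval v x y) (hE : u ∈ envelope v p q) : u ∈ envelope v x y := by
  obtain ⟨-, hext, hmax⟩ := hE
  rw [hk u hu] at hext hmax
  refine ⟨hu, ?_, ?_⟩
  · rw [mem_extremePoints_iff_left] at hext ⊢
    refine ⟨coordVec_mem_convInterval hu, ?_⟩
    rintro Q hQ R hR ⟨a, b, ha, hb, hab, he⟩
    refine add_right_cancel (b := k) (hext.2 _ (add_mem_convInterval hsub hk hQ) _
      (add_mem_convInterval hsub hk hR) ⟨a, b, ha, hb, hab, ?_⟩)
    rw [← he, smul_add, smul_add, add_add_add_comm, ← add_smul, hab, one_smul]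
  · rintro ⟨z, hz, h1, h2⟩
    refine hmax ⟨z + k, add_mem_convInterval hsub hk hz, ?_, ?_⟩
    · simpa using h1
    · simpa using h2

/-- The relation `(p,q) ⊲ (u,t)` forces `p`, `q` to be incomparable, and says that a functional
which is constant on `[v_{pq}(p), v_{pq}(q)]` is larger at `u` and `t` on average. -/
theorem MidpointAbove.pos_and_lt (hv : IsValuation v) {p q u t : L}
    (h : MidpointAbove v p q u t) :
    0 < v p - v (p ⊓ q) ∧ 0 < v q - v (p ⊓ q) ∧
      2 * ((v p - v (p ⊓ q)) * (v q - v (p ⊓ q))) <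
        (v q - v (p ⊓ q)) * ((coordVec v p q u).1 + (coordVec v p q t).1) +
          (v p - v (p ⊓ q)) * ((coordVec v p q u).2 + (coordVec v p q t).2) := by
  obtain ⟨-, -, h⟩ := h
  rw [coordVec_left, coordVec_right] at h
  have hle (x : L) : (coordVec v p q x).2 ≤ v q - v (p ⊓ q) :=
    sub_le_sub_right (hv.strictMono.monotone inf_le_right) _
  have h1 := hle u
  have h2 := hle t
  obtain ⟨ha, hb, hlt⟩ := h.pos_and_lt
    (sub_nonneg.2 (hv.strictMono.monotone inf_le_left))
    (sub_nonneg.2 (hv.strictMono.monotone inf_le_right)) (by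
      simp only [Prod.smul_snd, Prod.snd_add, smul_eq_mul]
      linarith)
  simp only [Prod.smul_snd, Prod.snd_add, smul_eq_mul, Prod.smul_fst, Prod.fst_add] at hlt
  exact ⟨ha, hb, by linarith⟩

variable [Finite L]

theorem exists_lexKey_max {w : ℝ × ℝ} (p q : L) {s : Set L} (hs : s.Nonempty) :
    ∃ m ∈ s, ∀ u ∈ s, lexKey w (coordVec v p q u) ≤ lexKey w (coordVec v p q m) :=
  Set.exists_max_image s _ s.toFinite hs

/-- The maximum of a positive functional over a metric interval is attained in its envelope. -/
theorem exists_mem_envelope_lexKey_max {w : ℝ × ℝ} (h1 : 0 < w.1) (h2 : 0 < w.2) {p q x y : L}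
    {k : ℝ × ℝ} (hne : (metricInterval v x y).Nonempty)
    (hk : ∀ u ∈ metricInterval v x y, coordVec v p q u = coordVec v x y u + k) :
    ∃ m ∈ envelope v x y, ∀ u ∈ metricInterval v x y,
      lexKey w (coordVec v p q u) ≤ lexKey w (coordVec v p q m) := by
  obtain ⟨m, hm, hmax⟩ := exists_lexKey_max (v := v) (w := w) x y hne
  refine ⟨m, ⟨hm, mem_extremePoints_of_lexKey h1 h2 (coordVec_mem_convInterval hm) ?_⟩, ?_⟩
  · refine convexHull_min ?_ (convex_lexKey_le w _)
    rintro _ ⟨u, hu, rfl⟩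
    exact hmax u hu
  · intro u hu
    rw [hk u hu, hk m hm, lexKey_add_right]
    exact hmax u hu

theorem strictlyAboveSegment_of_mem_envelope (hL : IsModularSemilattice L) (hv : IsValuation v)
    {p q u : L} (hu : u ∈ envelope v p q) (hup : u ≠ p) (huq : u ≠ q) :
    StrictlyAboveSegment (coordVec v p q p) (coordVec v p q q) (coordVec v p q u) := by
  obtain ⟨huI, hext, hmax⟩ := hu
  have hle := ((mem_metricInterval_iff hL hv).1 huI).1
  rw [coordVec_left, coordVec_right]
  refine strictlyAboveSegment_of_extreme (convex_convexHull ℝ _) ?_ ?_ ?_ ?_ ?_ hext hmax ?_ ?_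
  · rw [← coordVec_left]
    exact coordVec_mem_convInterval (left_mem_metricInterval hL hv p q)
  · rw [← coordVec_right]
    exact coordVec_mem_convInterval (right_mem_metricInterval hL hv p q)
  · exact sub_nonneg.2 (hv.strictMono.monotone (le_inf hle inf_le_left))
  · exact sub_le_sub_right (hv.strictMono.monotone inf_le_right) _
  · exact sub_nonneg.2 (hv.strictMono.monotone (le_inf hle inf_le_right))
  · rw [← coordVec_left]
    exact fun h => hup (eq_left_of_coordVec_eq hL hv huI h)
  · rw [← coordVec_right]
    exact fun h => huq (eq_right_of_coordVec_eq hL hv huI h)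

/-- Condition (1') enters only through the existence of some pair above the segment. The functional
`(b, a)` takes the value `a * b` on the whole segment. -/
theorem envelope_subset_of_midpointAbove (hL : IsModularSemilattice L) (hv : IsValuation v)
    {D : Set L}
    (H : ∀ p ∈ D, ∀ q ∈ D, (envelope v p q \ {p, q}).Nonempty →
      ∃ u, ∃ t ∈ D, MidpointAbove v p q u t)
    {p q : L} (hp : p ∈ D) (hq : q ∈ D) : envelope v p q ⊆ D := by
  induction hn : (metricInterval v p q).ncard using Nat.strong_induction_on generalizing p q with
  | _ n ih =>
  intro e he
  by_cases hep : e = p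
  · exact hep ▸ hp
  by_cases heq : e = q
  · exact heq ▸ hq
  obtain ⟨u, t₀, ht₀D, habove⟩ := H p hp q hq ⟨e, he, by simp [hep, heq]⟩
  obtain ⟨ha, hb, hlt⟩ := habove.pos_and_lt hv
  obtain ⟨⟨hu, -⟩, ⟨ht₀, ht₀pq⟩, -⟩ := habove
  simp only [Set.mem_insert_iff, Set.mem_singleton_iff, not_or] at ht₀pq
  set a := v p - v (p ⊓ q)
  set b := v q - v (p ⊓ q)
  have left (t : L) (ht : t ∈ metricInterval v p q) (htD : t ∈ D) (htq : t ≠ q) :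
      envelope v p t ⊆ D ∧ metricInterval v p t ⊆ metricInterval v p q := by
    have hss := metricInterval_ssubset hL hv ht htq
    exact ⟨ih _ (hn ▸ Set.ncard_lt_ncard hss (Set.toFinite _)) hp htD rfl, hss.subset⟩
  have right (t : L) (ht : t ∈ metricInterval v p q) (htD : t ∈ D) (htp : t ≠ p) :
      envelope v t q ⊆ D ∧ metricInterval v t q ⊆ metricInterval v p q := by
    have hss := metricInterval_ssubset' hL hv ht htp
    exact ⟨ih _ (hn ▸ Set.ncard_lt_ncard hss (Set.toFinite _)) htD hq rfl, hss.subset⟩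
  -- The functional's maximum over `I(p,t)` is attained in `ℰ(p,t)`, which lies in `D` by induction.
  have left_max (t : L) (ht : t ∈ metricInterval v p q) (htD : t ∈ D) (htq : t ≠ q)
      (x : L) (hx : x ∈ metricInterval v p t) : ∃ m ∈ metricInterval v p q ∩ D,
        lexKey (b, a) (coordVec v p q x) ≤ lexKey (b, a) (coordVec v p q m) := by
    obtain ⟨hE, hI⟩ := left t ht htD htq
    obtain ⟨m, hm, hmax⟩ := exists_mem_envelope_lexKey_max (w := (b, a)) hb ha ⟨x, hx⟩
      fun u hu => coordVec_left_eq_add hL hv (hI hu) hu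
    exact ⟨m, ⟨hI hm.1, hE hm⟩, hmax x hx⟩
  have right_max (t : L) (ht : t ∈ metricInterval v p q) (htD : t ∈ D) (htp : t ≠ p)
      (x : L) (hx : x ∈ metricInterval v t q) : ∃ m ∈ metricInterval v p q ∩ D,
        lexKey (b, a) (coordVec v p q x) ≤ lexKey (b, a) (coordVec v p q m) := by
    obtain ⟨hE, hI⟩ := right t ht htD htp
    obtain ⟨m, hm, hmax⟩ := exists_mem_envelope_lexKey_max (w := (b, a)) hb ha ⟨x, hx⟩
      fun u hu => coordVec_right_eq_add hL hv (hI hu) hu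
    exact ⟨m, ⟨hI hm.1, hE hm⟩, hmax x hx⟩
  obtain ⟨t, ⟨ht, htD⟩, htmax⟩ := exists_lexKey_max (v := v) (w := (b, a)) p q
    (s := metricInterval v p q ∩ D) ⟨p, left_mem_metricInterval hL hv p q, hp⟩
  -- The values at `x` and `y` sum to those at `t₀` and `u`, hence to more than `2 * a * b`, while
  -- neither exceeds the value at `t`.
  have htw : a * b < b * (coordVec v p q t).1 + a * (coordVec v p q t).2 := by
    obtain ⟨x, hx, y, hy, -, -, hxy, -⟩ := exists_parallelogram hL hv ht₀ hu
    obtain ⟨m, hm, hmx⟩ := left_max t₀ ht₀ ht₀D ht₀pq.2 x hx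
    obtain ⟨m', hm', hmy⟩ := right_max t₀ ht₀ ht₀D ht₀pq.1 y hy
    have e1 := functional_le_of_lexKey_le (hmx.trans (htmax m hm))
    have e2 := functional_le_of_lexKey_le (hmy.trans (htmax m' hm'))
    have e3 : (coordVec v p q x).1 + (coordVec v p q y).1 =
      (coordVec v p q t₀).1 + (coordVec v p q u).1 := congrArg Prod.fst hxy
    have e4 : (coordVec v p q x).2 + (coordVec v p q y).2 =
      (coordVec v p q t₀).2 + (coordVec v p q u).2 := congrArg Prod.snd hxy
    rw [add_comm (coordVec v p q u).1, add_comm (coordVec v p q u).2, ← e3, ← e4] at hlt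
    simp only at e1 e2
    linarith
  have htp : t ≠ p := by
    rintro rfl
    rw [coordVec_left] at htw
    simp only [mul_zero, add_zero] at htw
    linarith
  have htq : t ≠ q := by
    rintro rfl
    rw [coordVec_right] at htw
    simp only [mul_zero, zero_add] at htw
    linarith
  obtain ⟨x, hx, y, hy, hxI, hyI, hxy, ⟨hx1, hx2⟩, ⟨hy1, hy2⟩, ⟨hx3, hx4⟩, hy3, hy4⟩ :=
    exists_parallelogram hL hv ht he.1
  obtain ⟨m, hm, hmx⟩ := left_max t ht htD htq x hx
  obtain ⟨m', hm', hmy⟩ := right_max t ht htD htp y hy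
  have mono : ∀ {c d : L}, c ≤ d → v c - v (p ⊓ q) ≤ v d - v (p ⊓ q) :=
    fun h => sub_le_sub_right (hv.strictMono.monotone h) _
  -- The envelope point `e` is the vertex opposite to `t`, so its vector coincides with that of `x`
  -- or of `y`; the component inequalities upgrade this to equality of elements.
  rcases eq_of_parallelogram (convex_convexHull ℝ _) (w := (b, a)) hb ha
    (coordVec_mem_convInterval ht) (coordVec_mem_convInterval hxI)
    (coordVec_mem_convInterval hyI) hxy (mono hx3) (mono hx4) (mono hy3) (mono hy4)
    (functional_le_of_lexKey_le (hmx.trans (htmax m hm)))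
    (functional_le_of_lexKey_le (hmy.trans (htmax m' hm'))) he.2.1 he.2.2 with h | h
  · obtain rfl := eq_of_coordVec_eq hL hv he.1 hxI hx1 hx2 h
    obtain ⟨hE, hI⟩ := left t ht htD htq
    exact hE (mem_envelope_of_subset hI (fun u hu => coordVec_left_eq_add hL hv (hI hu) hu) hx he)
  · obtain rfl := eq_of_coordVec_eq hL hv hyI he.1 hy1 hy2 h.symm
    obtain ⟨hE, hI⟩ := right t ht htD htp
    exact hE (mem_envelope_of_subset hI (fun u hu => coordVec_right_eq_add hL hv (hI hu) hu) hy he)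

theorem exists_isClosestInEnvelope {p q : L} (r : L)
    (h : (envelope v p q \ {p, q}).Nonempty) : ∃ u, IsClosestInEnvelope v p q r u :=
  Set.exists_min_image _ (pathMetric v r) (Set.toFinite _) h

end Envelopes

theorem mainTheorem8 {L : Type*} [SemilatticeInf L] [Finite L]
    (hL : IsModularSemilattice L) (v : L → ℝ) (hv : IsValuation v) (f : L → WithTop ℝ) :
    (∀ p ∈ effDomain f, ∀ q ∈ effDomain f, envelope v p q ⊆ effDomain f) ↔
      (∀ p ∈ effDomain f, ∀ q ∈ effDomain f, envelope v p q ≠ {p, q} →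
        ∀ uminus uplus : L,
          IsClosestInEnvelope v p q p uminus → IsClosestInEnvelope v p q q uplus →
            ∃ t ∈ effDomain f, MidpointAbove v p q uminus t ∨ MidpointAbove v p q uplus t) := by
  constructor
  · rintro h p hp q hq - u - ⟨⟨hu, hupq⟩, -⟩ -
    -- With `t = u` the midpoint is the vector of `u` itself.
    refine ⟨u, h p hp q hq hu, Or.inl ⟨⟨hu.1, hupq⟩, ⟨hu.1, hupq⟩, ?_⟩⟩
    simp only [Set.mem_insert_iff, Set.mem_singleton_iff, not_or] at hupq
    rw [← two_smul ℝ, smul_smul, one_div_mul_cancel two_ne_zero, one_smul]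
    exact strictlyAboveSegment_of_mem_envelope hL hv hu hupq.1 hupq.2
  · intro h p hp q hq
    refine envelope_subset_of_midpointAbove hL hv (fun p hp q hq hne => ?_) hp hq
    obtain ⟨u, hu⟩ := exists_isClosestInEnvelope p hne
    obtain ⟨u', hu'⟩ := exists_isClosestInEnvelope q hne
    obtain ⟨t, ht, hut | hut⟩ := h p hp q hq (fun he => by simp [he] at hne) u u' hu hu'
    exacts [⟨u, t, ht, hut⟩, ⟨u', t, ht, hut⟩]
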